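/- A directed graph $E=(E^0,E^1,r,s)$ has vertex set $E^0$, edge set $E^1$ and range and source maps $r,s:E^1\to E^0$. A textile system $T=(E,F,p,q)$ consists of directed graphs $E,F$ and graph morphisms $p,q:F\to E$ such that $f\mapsto (p(f),q(f),r(f),s(f))$ is injective on $F^1$. The morphism $p$ has unique $r$-path lifting if, whenever $e\in E^1$ and $w\in F^0$ satisfy $r(e)=p(w)$, there is exactly one $f\in F^1$ with $r(f)=w$ and $p(f)=e$; unique $s$-path lifting is defined in the same way with $s$ in place of $r$. Let $G_T$ be the $2$-coloured graph with vertex set $E^0$ and edge set $E^1\sqcup F^0$, where $e\in E^1$ has colour $c_1$ and its source and range in $E$, and $w\in F^0$ has colour $c_2$, source $p(w)$ and range $q(w)$. A square in a $2$-coloured graph is a coloured-graph morphism from the graph $E_{2,e_1+e_2}$ with vertices $0,e_1,e_2,e_1+e_2$ and edges $\varepsilon_1^0,\varepsilon_2^0,\varepsilon_1^{e_2},\varepsilon_2^{e_1}$, where $\varepsilon_i^n$ has colour $c_i$, range $n$ and source $n+e_i$. Each $f\in F^1$ gives a square $\phi_f$ in $G_T$ by $\phi_f(\varepsilon_1^0)=q(f)$,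 $\phi_f(\varepsilon_2^0)=r(f)$, $\phi_f(\varepsilon_2^{e_1})=s(f)$, $\phi_f(\varepsilon_1^{e_2})=p(f)$; put $\mathcal C_T=\{\phi_f: f\in F^1\}$. A $2$-graph is a category $\Lambda$ with a degree functor $d:\Lambda\to\mathbb N^2$ with the factorisation property: whenever $d(\lambda)=m+n$ there are unique $\mu,\nu$ with $d(\mu)=m$, $d(\nu)=n$ and $\lambda=\mu\nu$. (Often $\Lambda$ is also required to be countable; this is not assumed here.) Write $\Lambda^n=d^{-1}(n)$ and $\Lambda^0$ for the objects. Its $1$-skeleton is the $2$-coloured graph $\mathrm{Sk}_\Lambda$ with vertices $\Lambda^0$ and edges $\Lambda^{e_1}\sqcup\Lambda^{e_2}$, those in $\Lambda^{e_i}$ having colour $c_i$, and $\mathcal C_\Lambda=\{\phi_\lambda:\lambda\in\Lambda^{e_1+e_2}\}$, where for $\lambda=f_1g_1=g_2f_2$ with $f_i\in\Lambda^{e_1}$, $g_i\in\Lambda^{e_2}$ the square $\phi_\lambda$ sends $\varepsilon_1^0,\varepsilon_2^{e_1},\varepsilon_2^0,\varepsilon_1^{e_2}$ to $f_1,g_1,g_2,f_2$.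 We write $(\mathrm{Sk}_\Lambda,\mathcal C_\Lambda)\cong(G_T,\mathcal C_T)$ if there is a coloured-graph isomorphism $\phi:\mathrm{Sk}_\Lambda\to G_T$ with $\phi\circ\psi\in\mathcal C_T$ for all $\psi\in\mathcal C_\Lambda$. The chain complex of $T$ is $0\to\mathbb ZF^1\xrightarrow{\partial_2^T}\mathbb ZE^1\oplus\mathbb ZF^0\xrightarrow{\partial_1^T}\mathbb ZE^0\to0$ with $\partial_1^T(e\oplus w)=s(e)-r(e)+p(w)-q(w)$ and $\partial_2^T(f)=(q(f)-p(f))\oplus(s(f)-r(f))$. The chain complex of a $2$-graph $\Lambda$ is $0\to\mathbb Z\Lambda^{e_1+e_2}\xrightarrow{\partial_2^\Lambda}\mathbb Z\Lambda^{e_1}\oplus\mathbb Z\Lambda^{e_2}\xrightarrow{\partial_1^\Lambda}\mathbb Z\Lambda^0\to0$ with $\partial_1^\Lambda(\lambda)=s(\lambda)-r(\lambda)$ and $\partial_2^\Lambda(\lambda)=f_1+g_1-f_2-g_2$ for $\lambda=f_1g_1=g_2f_2$ as above. Their homology groups are denoted $H_*(T)$ and $H_*(\Lambda)$. Theorem.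 Let $T=(E,F,p,q)$ be a textile system such that $p$ has unique $r$-path lifting and $q$ has unique $s$-path lifting. Then there is a $2$-graph $\Lambda_T$ with $(\mathrm{Sk}_{\Lambda_T},\mathcal C_{\Lambda_T})\cong(G_T,\mathcal C_T)$, which may be taken countable if $E^0,E^1,F^0$ are countable; and for every such $2$-graph $\Lambda_T$ the chain complex $(C_*(\Lambda_T),\partial_*^{\Lambda_T})$ is isomorphic to $(C_*(T),\partial_*^T)$, hence $H_n(\Lambda_T)\cong H_n(T)$ for all $n\ge 0$. -/

import Mathlib

open CategoryTheory

universe u v w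

namespace Textile

/-! ### Directed graphs, coloured graphs and squares -/

/-- A directed graph: a set `V` of vertices, a set `E` of edges, range and source maps. -/
structure DirectedGraph where
  V : Type u
  E : Type u
  r : E → V
  s : E → V

/-- A graph morphism from `F` to `E`. -/
@[ext]
structure DirectedGraph.Hom (F : DirectedGraph.{u}) (E : DirectedGraph.{v}) where
  onV : F.V → E.V
  onE : F.E → E.E
  r_onE : ∀ f, E.r (onE f) = onV (F.r f)
  s_onE : ∀ f, E.s (onE f) = onV (F.s f)

/-- A 2-coloured graph; the colour `c₁` is `0` and the colour `c₂` is `1`. -/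
structure ColouredGraph extends DirectedGraph.{u} where
  c : E → Fin 2

/-- A coloured-graph morphism. -/
@[ext]
structure ColouredGraph.Hom (F : ColouredGraph.{u}) (E : ColouredGraph.{v}) extends
    DirectedGraph.Hom F.toDirectedGraph E.toDirectedGraph where
  c_onE : ∀ f, E.c (onE f) = F.c f

/-- Composition `φ ∘ ψ` of coloured-graph morphisms. -/
def ColouredGraph.Hom.comp {G : ColouredGraph.{u}} {H : ColouredGraph.{v}} {K : ColouredGraph.{w}}
    (φ : H.Hom K) (ψ : G.Hom H) : G.Hom K where
  onV x := φ.onV (ψ.onV x)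
  onE e := φ.onE (ψ.onE e)
  r_onE e := by rw [φ.r_onE, ψ.r_onE]
  s_onE e := by rw [φ.s_onE, ψ.s_onE]
  c_onE e := by rw [φ.c_onE, ψ.c_onE]

/-- The vertices `0`, `e₁`, `e₂`, `e₁ + e₂` of the model graph `E_{2,e₁+e₂}`. -/
inductive ModelVertex : Type
  | zero
  | e₁
  | e₂
  | e₁₂

/-- The edges `ε₁⁰`, `ε₂⁰`, `ε₁^{e₂}`, `ε₂^{e₁}` of the model graph `E_{2,e₁+e₂}`. -/
inductive ModelEdge : Type
  | ε₁zero
  | ε₂zero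
  | ε₁e₂
  | ε₂e₁

/-- The 2-coloured graph `E_{2,e₁+e₂}`: the edge `ε_iⁿ` has range `n`, source `n + e_i` and
colour `c_i`. -/
def modelSquare : ColouredGraph.{0} where
  V := ModelVertex
  E := ModelEdge
  r
    | .ε₁zero => .zero
    | .ε₂zero => .zero
    | .ε₁e₂ => .e₂
    | .ε₂e₁ => .e₁
  s
    | .ε₁zero => .e₁
    | .ε₂zero => .e₂
    | .ε₁e₂ => .e₁₂
    | .ε₂e₁ => .e₁₂
  c
    | .ε₁zero => 0
    | .ε₂zero => 1
    | .ε₁e₂ => 0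
    | .ε₂e₁ => 1

/-- A square in a 2-coloured graph `G` is a coloured-graph morphism `E_{2,e₁+e₂} → G`. -/
abbrev ColouredGraph.Square (G : ColouredGraph.{u}) : Type u :=
  modelSquare.Hom G

/-- `(G, C)` and `(H, D)` are square-isomorphic: there is a coloured-graph isomorphism
`φ : G → H` with `φ ∘ ψ ∈ D` for each `ψ ∈ C`. -/
def SquareIsomorphic (G : ColouredGraph.{u}) (C : Set G.Square)
    (H : ColouredGraph.{v}) (D : Set H.Square) : Prop :=
  ∃ φ : G.Hom H, Function.Bijective φ.onV ∧ Function.Bijective φ.onE ∧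
    ∀ ψ ∈ C, φ.comp ψ ∈ D

/-! ### Path lifting and textile systems -/

/-- `p : F → E` has unique `r`-path lifting. -/
def DirectedGraph.Hom.UniqueRPathLifting {F : DirectedGraph.{u}} {E : DirectedGraph.{v}}
    (p : F.Hom E) : Prop :=
  ∀ (e : E.E) (w : F.V), E.r e = p.onV w → ∃! f : F.E, F.r f = w ∧ p.onE f = e

/-- `p : F → E` has unique `s`-path lifting. -/
def DirectedGraph.Hom.UniqueSPathLifting {F : DirectedGraph.{u}} {E : DirectedGraph.{v}}
    (p : F.Hom E) : Prop :=
  ∀ (e : E.E) (w : F.V), E.s e = p.onV w → ∃! f : F.E, F.s f = w ∧ p.onE f = e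

/-- A textile system `T = (E, F, p, q)`. -/
structure TextileSystem where
  E : DirectedGraph.{u}
  F : DirectedGraph.{u}
  p : F.Hom E
  q : F.Hom E
  injective : Function.Injective fun f : F.E => (p.onE f, q.onE f, F.r f, F.s f)

/-- The 2-coloured graph `G_T`: its vertices are those of `E`, its edges of colour `c₁` are those
of `E`, and each vertex `w` of `F` is an edge of colour `c₂` with source `p w` and range `q w`. -/
def TextileSystem.colouredGraph (T : TextileSystem.{u}) : ColouredGraph.{u} where
  V := T.E.V
  E := T.E.E ⊕ T.F.V
  r := Sum.elim T.E.r T.q.onV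
  s := Sum.elim T.E.s T.p.onV
  c := Sum.elim (fun _ => 0) (fun _ => 1)

/-- The square `φ_f` in `G_T` given by an edge `f` of `F`. -/
def TextileSystem.square (T : TextileSystem.{u}) (f : T.F.E) : T.colouredGraph.Square where
  onV
    | .zero => T.E.r (T.q.onE f)
    | .e₁ => T.E.s (T.q.onE f)
    | .e₂ => T.E.r (T.p.onE f)
    | .e₁₂ => T.E.s (T.p.onE f)
  onE
    | .ε₁zero => Sum.inl (T.q.onE f)
    | .ε₂zero => Sum.inr (T.F.r f)
    | .ε₁e₂ => Sum.inl (T.p.onE f)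
    | .ε₂e₁ => Sum.inr (T.F.s f)
  r_onE
    | .ε₁zero => rfl
    | .ε₂zero => (T.q.r_onE f).symm
    | .ε₁e₂ => rfl
    | .ε₂e₁ => (T.q.s_onE f).symm
  s_onE
    | .ε₁zero => rfl
    | .ε₂zero => (T.p.r_onE f).symm
    | .ε₁e₂ => rfl
    | .ε₂e₁ => (T.p.s_onE f).symm
  c_onE
    | .ε₁zero => rfl
    | .ε₂zero => rfl
    | .ε₁e₂ => rfl
    | .ε₂e₁ => rfl

/-- The collection `C_T` of squares in `G_T`. -/
def TextileSystem.squares (T : TextileSystem.{u}) : Set T.colouredGraph.Square :=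
  Set.range T.square

/-! ### 2-graphs -/

/-- A category with a degree functor to `ℕ²` that has the factorisation property, that is, a
2-graph in which countability is not required (it is `TwoGraph.IsCountable` below). A morphism
`x ⟶ y` has source `x` and range `y`, so the product `μν` of the 2-graph literature
(where `s(μ) = r(ν)`) is `ν ≫ μ`. -/
structure TwoGraph where
  Obj : Type u
  [cat : Category.{u} Obj]
  d : ∀ {x y : Obj}, (x ⟶ y) → ℕ × ℕ
  d_id : ∀ x : Obj, d (𝟙 x) = 0
  d_comp : ∀ {x y z : Obj} (ν : x ⟶ y) (μ : y ⟶ z), d (ν ≫ μ) = d μ + d ν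
  factorisation : ∀ {x y : Obj} (l : x ⟶ y) (m n : ℕ × ℕ), d l = m + n →
    ∃! t : Σ z : Obj, (z ⟶ y) × (x ⟶ z), d t.2.1 = m ∧ d t.2.2 = n ∧ t.2.2 ≫ t.2.1 = l

namespace TwoGraph

attribute [instance] TwoGraph.cat

/-- The category has countably many morphisms (hence countably many objects). -/
def IsCountable (L : TwoGraph.{u}) : Prop :=
  Countable (Σ x y : L.Obj, (x ⟶ y))

/-- The set `Λⁿ` of morphisms of degree `n`. -/
@[ext]
structure OfDegree (L : TwoGraph.{u}) (n : ℕ × ℕ) where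
  src : L.Obj
  rng : L.Obj
  hom : src ⟶ rng
  deg : L.d hom = n

variable (L : TwoGraph.{u})

/-- The factors `(μ, ν)` in the factorisation `l = μν` with `d μ = m` and `d ν = n`. -/
noncomputable def factor {x y : L.Obj} (l : x ⟶ y) (m n : ℕ × ℕ) (h : L.d l = m + n) :
    Σ z : L.Obj, (z ⟶ y) × (x ⟶ z) :=
  (L.factorisation l m n h).choose

theorem factor_spec {x y : L.Obj} (l : x ⟶ y) (m n : ℕ × ℕ) (h : L.d l = m + n) :
    L.d (L.factor l m n h).2.1 = m ∧ L.d (L.factor l m n h).2.2 = n ∧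
      (L.factor l m n h).2.2 ≫ (L.factor l m n h).2.1 = l :=
  (L.factorisation l m n h).choose_spec.1

variable {L}

/-- The initial segment `l(0, m)` of `l` of degree `m + n`. -/
noncomputable def OfDegree.head {k : ℕ × ℕ} (l : L.OfDegree k) (m n : ℕ × ℕ) (h : k = m + n) :
    L.OfDegree m where
  src := (L.factor l.hom m n (l.deg.trans h)).1
  rng := l.rng
  hom := (L.factor l.hom m n (l.deg.trans h)).2.1
  deg := (L.factor_spec l.hom m n (l.deg.trans h)).1

/-- The final segment `l(m, m + n)` of `l` of degree `m + n`. -/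
noncomputable def OfDegree.tail {k : ℕ × ℕ} (l : L.OfDegree k) (m n : ℕ × ℕ) (h : k = m + n) :
    L.OfDegree n where
  src := l.src
  rng := (L.factor l.hom m n (l.deg.trans h)).1
  hom := (L.factor l.hom m n (l.deg.trans h)).2.2
  deg := (L.factor_spec l.hom m n (l.deg.trans h)).2.1

/-- For `l = f₁g₁ = g₂f₂` with `fᵢ` of degree `e₁` and `gᵢ` of degree `e₂`: the factor `f₁`. -/
noncomputable def f₁ (l : L.OfDegree (1, 1)) : L.OfDegree (1, 0) := l.head (1, 0) (0, 1) rfl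

/-- The factor `g₁` in `l = f₁g₁`. -/
noncomputable def g₁ (l : L.OfDegree (1, 1)) : L.OfDegree (0, 1) := l.tail (1, 0) (0, 1) rfl

/-- The factor `g₂` in `l = g₂f₂`. -/
noncomputable def g₂ (l : L.OfDegree (1, 1)) : L.OfDegree (0, 1) := l.head (0, 1) (1, 0) rfl

/-- The factor `f₂` in `l = g₂f₂`. -/
noncomputable def f₂ (l : L.OfDegree (1, 1)) : L.OfDegree (1, 0) := l.tail (0, 1) (1, 0) rfl

variable (L)

/-- The 1-skeleton of a 2-graph. -/
def skeleton : ColouredGraph.{u} where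
  V := L.Obj
  E := L.OfDegree (1, 0) ⊕ L.OfDegree (0, 1)
  r := Sum.elim OfDegree.rng OfDegree.rng
  s := Sum.elim OfDegree.src OfDegree.src
  c := Sum.elim (fun _ => 0) (fun _ => 1)

/-- The square `φ_l` in the 1-skeleton, `φ_l(ε_iⁿ) = l(n, n + e_i)`, for `l` of degree
`e₁ + e₂`. -/
noncomputable def square (l : L.OfDegree (1, 1)) : L.skeleton.Square where
  onV
    | .zero => l.rng
    | .e₁ => (f₁ l).src
    | .e₂ => (g₂ l).src
    | .e₁₂ => l.src
  onE
    | .ε₁zero => Sum.inl (f₁ l)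
    | .ε₂zero => Sum.inr (g₂ l)
    | .ε₁e₂ => Sum.inl (f₂ l)
    | .ε₂e₁ => Sum.inr (g₁ l)
  r_onE
    | .ε₁zero => rfl
    | .ε₂zero => rfl
    | .ε₁e₂ => rfl
    | .ε₂e₁ => rfl
  s_onE
    | .ε₁zero => rfl
    | .ε₂zero => rfl
    | .ε₁e₂ => rfl
    | .ε₂e₁ => rfl
  c_onE
    | .ε₁zero => rfl
    | .ε₂zero => rfl
    | .ε₁e₂ => rfl
    | .ε₂e₁ => rfl

/-- The canonical collection `C_Λ` of squares in the 1-skeleton. -/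
def squares : Set L.skeleton.Square :=
  Set.range L.square

end TwoGraph

/-- `L` is (a copy of) the 2-graph `Λ_T` of the textile system `T`: its 1-skeleton with the
canonical collection of squares is square-isomorphic to `(G_T, C_T)`. -/
def TextileSystem.IsAssociatedTwoGraph (T : TextileSystem.{u}) (L : TwoGraph.{u}) : Prop :=
  SquareIsomorphic L.skeleton L.squares T.colouredGraph T.squares

/-! ### Chain complexes -/

/-- The groups `C₀, C₁, C₂, 0, 0, …`. -/
def threeTermObj (C₀ C₁ C₂ : AddCommGrpCat.{u}) : ℕ → AddCommGrpCat.{u}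
  | 0 => C₀
  | 1 => C₁
  | 2 => C₂
  | _ + 3 => AddCommGrpCat.of PUnit

/-- The differentials `∂₁, ∂₂, 0, 0, …`. -/
def threeTermD {C₀ C₁ C₂ : AddCommGrpCat.{u}} (d₁ : C₁ ⟶ C₀) (d₂ : C₂ ⟶ C₁) :
    ∀ n : ℕ, threeTermObj C₀ C₁ C₂ (n + 1) ⟶ threeTermObj C₀ C₁ C₂ n
  | 0 => d₁
  | 1 => d₂
  | _ + 2 => 0

theorem threeTermD_comp {C₀ C₁ C₂ : AddCommGrpCat.{u}} (d₁ : C₁ ⟶ C₀) (d₂ : C₂ ⟶ C₁)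
    (h : d₂ ≫ d₁ = 0) : ∀ n : ℕ, threeTermD d₁ d₂ (n + 1) ≫ threeTermD d₁ d₂ n = 0
  | 0 => h
  | 1 => Limits.zero_comp
  | _ + 2 => Limits.zero_comp

/-- The chain complex `0 → C₂ → C₁ → C₀ → 0`, with `Cᵢ` in degree `i`. -/
noncomputable def threeTermComplex {C₀ C₁ C₂ : AddCommGrpCat.{u}} (d₁ : C₁ ⟶ C₀) (d₂ : C₂ ⟶ C₁)
    (h : d₂ ≫ d₁ = 0) : ChainComplex AddCommGrpCat.{u} ℕ :=
  ChainComplex.of (threeTermObj C₀ C₁ C₂) (threeTermD d₁ d₂) (threeTermD_comp d₁ d₂ h)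

/-- The boundary `e ↦ s(e) - r(e)` of a directed graph. -/
def DirectedGraph.boundary (E : DirectedGraph.{u}) :
    FreeAbelianGroup E.E →+ FreeAbelianGroup E.V :=
  FreeAbelianGroup.lift fun e => FreeAbelianGroup.of (E.s e) - FreeAbelianGroup.of (E.r e)

namespace TextileSystem

variable (T : TextileSystem.{u})

/-- `∂₁(e ⊕ w) = ∂^E(e) + (p⁰ - q⁰)(w)`. -/
def boundary₁ :
    FreeAbelianGroup T.E.E × FreeAbelianGroup T.F.V →+ FreeAbelianGroup T.E.V :=
  T.E.boundary.coprod (FreeAbelianGroup.map T.p.onV - FreeAbelianGroup.map T.q.onV)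

/-- `∂₂(f) = (q¹ - p¹)(f) ⊕ ∂^F(f)`. -/
def boundary₂ :
    FreeAbelianGroup T.F.E →+ FreeAbelianGroup T.E.E × FreeAbelianGroup T.F.V :=
  (FreeAbelianGroup.map T.q.onE - FreeAbelianGroup.map T.p.onE).prod T.F.boundary

theorem boundary_comp : T.boundary₁.comp T.boundary₂ = 0 := by
  apply FreeAbelianGroup.lift_ext
  intro f
  simp only [boundary₁, boundary₂, DirectedGraph.boundary, AddMonoidHom.comp_apply,
    AddMonoidHom.prod_apply, AddMonoidHom.coprod_apply, AddMonoidHom.sub_apply,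
    FreeAbelianGroup.map_of_apply, FreeAbelianGroup.lift_apply_of, map_sub,
    T.p.r_onE, T.p.s_onE, T.q.r_onE, T.q.s_onE, AddMonoidHom.zero_apply]
  abel

/-- The chain complex of a textile system. -/
noncomputable def chainComplex : ChainComplex AddCommGrpCat.{u} ℕ :=
  threeTermComplex (AddCommGrpCat.ofHom T.boundary₁) (AddCommGrpCat.ofHom T.boundary₂)
    (by rw [← AddCommGrpCat.ofHom_comp, T.boundary_comp]; rfl)

end TextileSystem

namespace TwoGraph

variable (L : TwoGraph.{u})

/-- `∂₁(l) = s(l) - r(l)` on `ℤΛ^{e₁} ⊕ ℤΛ^{e₂}`. -/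
def boundary₁ :
    FreeAbelianGroup (L.OfDegree (1, 0)) × FreeAbelianGroup (L.OfDegree (0, 1)) →+
      FreeAbelianGroup L.Obj :=
  AddMonoidHom.coprod
    (FreeAbelianGroup.lift fun e => FreeAbelianGroup.of e.src - FreeAbelianGroup.of e.rng)
    (FreeAbelianGroup.lift fun e => FreeAbelianGroup.of e.src - FreeAbelianGroup.of e.rng)

/-- `∂₂(l) = f₁ + g₁ - f₂ - g₂` where `l = f₁g₁ = g₂f₂`. -/
noncomputable def boundary₂ :
    FreeAbelianGroup (L.OfDegree (1, 1)) →+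
      FreeAbelianGroup (L.OfDegree (1, 0)) × FreeAbelianGroup (L.OfDegree (0, 1)) :=
  FreeAbelianGroup.lift fun l =>
    (FreeAbelianGroup.of (f₁ l) - FreeAbelianGroup.of (f₂ l),
      FreeAbelianGroup.of (g₁ l) - FreeAbelianGroup.of (g₂ l))

theorem boundary_comp : L.boundary₁.comp L.boundary₂ = 0 := by
  apply FreeAbelianGroup.lift_ext
  intro l
  simp only [boundary₁, boundary₂, AddMonoidHom.comp_apply,
    AddMonoidHom.coprod_apply, FreeAbelianGroup.lift_apply_of, map_sub,
    AddMonoidHom.zero_apply]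
  simp only [f₁, f₂, g₁, g₂, OfDegree.head, OfDegree.tail]
  abel

/-- The (cubical) chain complex of a 2-graph. -/
noncomputable def chainComplex : ChainComplex AddCommGrpCat.{u} ℕ :=
  threeTermComplex (AddCommGrpCat.ofHom L.boundary₁) (AddCommGrpCat.ofHom L.boundary₂)
    (by rw [← AddCommGrpCat.ofHom_comp, L.boundary_comp]; rfl)

end TwoGraph

end Textile

/-! An edge $f$ of $F$ is a square whose red-blue side is $(r(f),p(f))$ and whose blue-red side is
$(q(f),s(f))$. Unique $r$-path lifting of $p$ says that $f$ is determined by an arbitrary composable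
red-blue pair; unique $s$-path lifting of $q$ says the same for blue-red pairs. The squares thus
give a bijection between the two kinds of pairs (`exchange`). With only two colours no further
coherence is needed: morphisms are words "blue path, then red path", multiplied by pushing red
letters right past blue ones. Associativity is formal (`mul_assoc`), and the factorisation property
is the bijectivity of pushing on paths (`push_inj`, `push_surj`).

For the second claim, in any 2-graph a morphism of degree $e_1+e_2$ is the same as a composable pair
$(f_1,g_1)$, and an edge of $F$ the same as a composable pair $(q(f),s(f))$. A square isomorphism
therefore induces a bijection in degree 2 as well, and the boundary formulas match under
$f_1,f_2,g_1,g_2\leftrightarrow q,p,s,r$ (`exists_equivs`). -/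

namespace Textile

/-! ### Words in two alphabets -/

namespace Word

variable {B W : Type u} (σ : W → B → B × W)

/-- Move the letter `w` to the right, past the word `l`, by the rule `w b = b' w'` for
`σ w b = (b', w')`. -/
def pushLetter (w : W) : List B → List B × W
  | [] => ([], w)
  | b :: l => ((σ w b).1 :: (pushLetter (σ w b).2 l).1, (pushLetter (σ w b).2 l).2)

/-- Move the word `u` to the right, past the word `l`. -/
def push : List W → List B → List B × List W
  | [], l => (l, [])
  | w :: u, l =>
    ((pushLetter σ w (push u l).1).1, (pushLetter σ w (push u l).1).2 :: (push u l).2)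

theorem pushLetter_append (w : W) (a b : List B) :
    pushLetter σ w (a ++ b) =
      ((pushLetter σ w a).1 ++ (pushLetter σ (pushLetter σ w a).2 b).1,
        (pushLetter σ (pushLetter σ w a).2 b).2) := by
  induction a generalizing w with
  | nil => rfl
  | cons x a ih => simp [pushLetter, ih]

theorem push_nil (u : List W) : push σ u [] = ([], u) := by
  induction u with
  | nil => rfl
  | cons w u ih => simp [push, ih, pushLetter]

theorem push_append_left (u v : List W) (l : List B) :
    push σ (u ++ v) l =
      ((push σ u (push σ v l).1).1, (push σ u (push σ v l).1).2 ++ (push σ v l).2) := by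
  induction u with
  | nil => rfl
  | cons w u ih => simp [push, ih]

theorem push_append_right (u : List W) (a b : List B) :
    push σ u (a ++ b) =
      ((push σ u a).1 ++ (push σ (push σ u a).2 b).1, (push σ (push σ u a).2 b).2) := by
  induction u with
  | nil => rfl
  | cons w u ih => simp [push, ih, pushLetter_append]

theorem length_pushLetter (w : W) (l : List B) : (pushLetter σ w l).1.length = l.length := by
  induction l generalizing w with
  | nil => rfl
  | cons b l ih => simp [pushLetter, ih]

theorem length_push (u : List W) (l : List B) :
    (push σ u l).1.length = l.length ∧ (push σ u l).2.length = u.length := by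
  induction u with
  | nil => simp [push]
  | cons w u ih => simp [push, length_pushLetter, ih]

/-- The product of the words `a u` and `b v`. -/
def mul (s t : List B × List W) : List B × List W :=
  (s.1 ++ (push σ s.2 t.1).1, (push σ s.2 t.1).2 ++ t.2)

/-- Both sides expand to the same word by the two append rules for `push`. This holds for an
arbitrary total rule `σ`, so composability plays no role. -/
theorem mul_assoc (s t k : List B × List W) : mul σ (mul σ s t) k = mul σ s (mul σ t k) := by
  simp [mul, push_append_left, push_append_right]

theorem one_mul (t : List B × List W) : mul σ ([], []) t = t := rfl

theorem mul_one (t : List B × List W) : mul σ t ([], []) = t := by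
  simp [mul, push_nil]

end Word

/-! ### Paths as lists of edges -/

/-- The list `l` of edges is a path with range `x` and source `y`. -/
def IsPath {V A : Type u} (r s : A → V) : V → List A → V → Prop
  | x, [], y => x = y
  | x, e :: l, y => r e = x ∧ IsPath r s (s e) l y

theorem isPath_append {V A : Type u} {r s : A → V} {x y : V} {l l' : List A} :
    IsPath r s x (l ++ l') y ↔ ∃ z, IsPath r s x l z ∧ IsPath r s z l' y := by
  induction l generalizing x with
  | nil => simp [IsPath]
  | cons e l ih => simp [IsPath, ih, and_assoc]

/-- Blue edges `B` and red edges `W` on the vertex set `V`, and a bijection from the composable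
pairs (red, blue) to the composable pairs (blue, red) with the same range and source. -/
structure Exchange where
  V : Type u
  B : Type u
  W : Type u
  rB : B → V
  sB : B → V
  rW : W → V
  sW : W → V
  -- A total function; its values on non-composable pairs are arbitrary, and every law below is
  -- restricted to composable ones.
  swap : W → B → B × W
  rB_swap : ∀ w b, sW w = rB b → rB (swap w b).1 = rW w
  sB_swap : ∀ w b, sW w = rB b → sB (swap w b).1 = rW (swap w b).2
  sW_swap : ∀ w b, sW w = rB b → sW (swap w b).2 = sB b
  swap_inj : ∀ w b w' b', sW w = rB b → sW w' = rB b' → swap w b = swap w' b' → w = w' ∧ b = b'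
  swap_surj : ∀ b w, sB b = rW w → ∃ w' b', sW w' = rB b' ∧ swap w' b' = (b, w)

namespace Exchange

open Word

variable (X : Exchange.{u})

/-- Blue paths. -/
abbrev BluePath : X.V → List X.B → X.V → Prop := IsPath X.rB X.sB

/-- Red paths. -/
abbrev RedPath : X.V → List X.W → X.V → Prop := IsPath X.rW X.sW

/-! ### Pushing is a bijection from red-blue paths to blue-red paths -/

variable {X}

/-- Each exchange replaces one side of a square by the opposite side, so the outer endpoints
persist; the new middle vertex is the range of the outgoing red letter. -/
theorem path_pushLetter {w : X.W} {l : List X.B} {y : X.V} (h : X.BluePath (X.sW w) l y) :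
    X.BluePath (X.rW w) (pushLetter X.swap w l).1 (X.rW (pushLetter X.swap w l).2) ∧
      X.sW (pushLetter X.swap w l).2 = y := by
  induction l generalizing w with
  | nil => exact ⟨rfl, h⟩
  | cons b l ih =>
    obtain ⟨h₁, h₂⟩ := h
    rw [← X.sW_swap w b h₁.symm] at h₂
    obtain ⟨h₃, h₄⟩ := ih h₂
    rw [← X.sB_swap w b h₁.symm] at h₃
    exact ⟨⟨X.rB_swap w b h₁.symm, h₃⟩, h₄⟩

theorem path_push {u : List X.W} {l : List X.B} {x z y : X.V} (hu : X.RedPath x u z)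
    (hl : X.BluePath z l y) :
    ∃ z', X.BluePath x (push X.swap u l).1 z' ∧ X.RedPath z' (push X.swap u l).2 y := by
  induction u generalizing x with
  | nil => cases hu; exact ⟨y, hl, rfl⟩
  | cons w u ih =>
    obtain ⟨rfl, hu⟩ := hu
    obtain ⟨z', h₁, h₂⟩ := ih hu
    obtain ⟨h₃, h₄⟩ := path_pushLetter h₁
    exact ⟨_, h₃, rfl, h₄ ▸ h₂⟩

/-- Squares are undone from the far end: induction recovers the blue tail and the red letter
entering it, and `swap_inj` then recovers the first square. -/
theorem pushLetter_inj {w w' : X.W} {l l' : List X.B} {y y' : X.V}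
    (h : X.BluePath (X.sW w) l y) (h' : X.BluePath (X.sW w') l' y')
    (e : pushLetter X.swap w l = pushLetter X.swap w' l') : w = w' ∧ l = l' := by
  induction l generalizing w w' l' with
  | nil =>
    cases l' with
    | nil => simpa [pushLetter] using e
    | cons b' l' => simp [pushLetter] at e
  | cons b l ih =>
    cases l' with
    | nil => simp [pushLetter] at e
    | cons b' l' =>
      obtain ⟨h₁, h₂⟩ := h
      obtain ⟨h₁', h₂'⟩ := h'
      rw [← X.sW_swap w b h₁.symm] at h₂
      rw [← X.sW_swap w' b' h₁'.symm] at h₂'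
      simp only [pushLetter, Prod.mk.injEq, List.cons.injEq] at e
      obtain ⟨e₁, rfl⟩ := ih h₂ h₂' (Prod.ext e.1.2 e.2)
      obtain ⟨rfl, rfl⟩ := X.swap_inj w b w' b' h₁.symm h₁'.symm (Prod.ext e.1.1 e₁)
      exact ⟨rfl, rfl⟩

theorem push_inj {u u' : List X.W} {l l' : List X.B} {x z y x' z' y' : X.V}
    (hu : X.RedPath x u z) (hl : X.BluePath z l y)
    (hu' : X.RedPath x' u' z') (hl' : X.BluePath z' l' y')
    (e : push X.swap u l = push X.swap u' l') : u = u' ∧ l = l' := by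
  induction u generalizing u' x x' with
  | nil =>
    cases u' with
    | nil => simpa [push] using e
    | cons w' u' => simp [push] at e
  | cons w u ih =>
    cases u' with
    | nil => simp [push] at e
    | cons w' u' =>
      simp only [push, Prod.mk.injEq, List.cons.injEq] at e
      -- `swap` is injective on composable pairs only, so the blue word met by `w` must be known to
      -- be a path starting at its source.
      obtain ⟨m, h₁, -⟩ := path_push hu.2 hl
      obtain ⟨m', h₁', -⟩ := path_push hu'.2 hl'
      obtain ⟨rfl, e₁⟩ := pushLetter_inj h₁ h₁' (Prod.ext e.1 e.2.1)
      obtain ⟨rfl, rfl⟩ := ih hu.2 hu'.2 (Prod.ext e₁ e.2.2)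
      exact ⟨rfl, rfl⟩

theorem pushLetter_surj {w : X.W} {l : List X.B} {x : X.V} (h : X.BluePath x l (X.rW w)) :
    ∃ w' l', X.rW w' = x ∧ X.BluePath (X.sW w') l' (X.sW w) ∧
      pushLetter X.swap w' l' = (l, w) := by
  induction l generalizing x with
  | nil => exact ⟨w, [], h.symm, rfl, rfl⟩
  | cons b l ih =>
    obtain ⟨w₁, l', h₁, h₂, h₃⟩ := ih h.2
    obtain ⟨w', b', h₄, h₅⟩ := X.swap_surj b w₁ h₁.symm
    have h₆ := X.rB_swap w' b' h₄
    have h₇ := X.sW_swap w' b' h₄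
    rw [h₅] at h₆ h₇
    refine ⟨w', b' :: l', h₆.symm.trans h.1, ⟨h₄.symm, h₇ ▸ h₂⟩, ?_⟩
    simp [pushLetter, h₅, h₃]

/-- The red letters are pulled left one at a time, beginning with the one adjacent to the blue path.
-/
theorem push_surj {u : List X.W} {l : List X.B} {x z y : X.V} (hl : X.BluePath x l z)
    (hu : X.RedPath z u y) :
    ∃ u' l' z', X.RedPath x u' z' ∧ X.BluePath z' l' y ∧ push X.swap u' l' = (l, u) := by
  induction u generalizing x z l with
  | nil => cases hu; exact ⟨[], l, x, rfl, hl, rfl⟩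
  | cons w u ih =>
    obtain ⟨rfl, hu⟩ := hu
    obtain ⟨w', l₁, h₁, h₂, h₃⟩ := pushLetter_surj hl
    obtain ⟨u', l', z', h₄, h₅, h₆⟩ := ih h₂ hu
    refine ⟨w' :: u', l', z', ⟨h₁, h₄⟩, h₅, ?_⟩
    simp [push, h₆, h₃]

/-! ### The category of words -/

variable (X)

/-- The words `a u`, with `a` blue and `u` red, that are paths with range `y` and source `x`. -/
def IsMorphism (x y : X.V) (t : List X.B × List X.W) : Prop :=
  ∃ z, X.BluePath y t.1 z ∧ X.RedPath z t.2 x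

variable {X}

theorem IsMorphism.mul {x y z : X.V} {s t : List X.B × List X.W} (hs : X.IsMorphism y z s)
    (ht : X.IsMorphism x y t) : X.IsMorphism x z (mul X.swap s t) := by
  obtain ⟨m, h₁, h₂⟩ := hs
  obtain ⟨n, h₃, h₄⟩ := ht
  obtain ⟨k, h₅, h₆⟩ := path_push h₂ h₃
  exact ⟨k, isPath_append.2 ⟨m, h₁, h₅⟩, isPath_append.2 ⟨n, h₆, h₄⟩⟩

variable (X)

/-- The category of paths modulo the exchange of red and blue edges. -/
abbrev category : Category.{u} X.V where
  Hom x y := { t : List X.B × List X.W // X.IsMorphism x y t }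
  id x := ⟨([], []), x, rfl, rfl⟩
  -- Words are written range first, so the later morphism `g` is the left factor.
  comp f g := ⟨mul X.swap g.1 f.1, g.2.mul f.2⟩
  id_comp f := Subtype.ext (mul_one X.swap f.1)
  comp_id f := Subtype.ext (one_mul X.swap f.1)
  assoc f g h := Subtype.ext (mul_assoc X.swap h.1 g.1 f.1).symm

/-- The bidegree of a word. -/
def degree (t : List X.B × List X.W) : ℕ × ℕ := (t.1.length, t.2.length)

theorem degree_mul (s t : List X.B × List X.W) :
    X.degree (mul X.swap s t) = X.degree s + X.degree t := by
  simp [degree, mul, length_push]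

/-! ### The factorisation property -/

variable {X}

/-- Cut the word as $a_1a_2u_1u_2$ at the lengths prescribed by `m`, and rewrite the inner $a_2u_1$
as a red-blue path $u'a'$; the factors are $a_1u'$ and $a'u_2$. -/
theorem exists_factorisation {x y : X.V} {t : List X.B × List X.W} (ht : X.IsMorphism x y t)
    {m n : ℕ × ℕ} (h : X.degree t = m + n) :
    ∃ z s k, X.IsMorphism z y s ∧ X.IsMorphism x z k ∧ X.degree s = m ∧ X.degree k = n ∧
      mul X.swap s k = t := by
  obtain ⟨a, u⟩ := t
  obtain ⟨v, ha, hu⟩ := ht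
  simp only [degree, Prod.ext_iff, Prod.fst_add, Prod.snd_add] at h
  dsimp only [BluePath, RedPath] at ha hu
  rw [← List.take_append_drop m.1 a, isPath_append] at ha
  rw [← List.take_append_drop m.2 u, isPath_append] at hu
  obtain ⟨v₁, h₁, h₂⟩ := ha
  obtain ⟨v₂, h₃, h₄⟩ := hu
  obtain ⟨u', a', z, h₅, h₆, h₇⟩ := push_surj h₂ h₃
  have hlen := length_push X.swap u' a'
  rw [h₇] at hlen
  simp only [List.length_take, List.length_drop] at hlen
  refine ⟨z, (a.take m.1, u'), (a', u.drop m.2), ⟨v₁, h₁, h₅⟩, ⟨v₂, h₆, h₄⟩, ?_, ?_, ?_⟩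
  · ext <;> simp only [degree, List.length_take] <;> omega
  · ext <;> simp only [degree, List.length_drop] <;> omega
  · simp [mul, h₇]

/-- Equal degrees allow the outer blue and red segments to be cancelled by length; the inner
segments agree by `push_inj`. -/
theorem factorisation_unique {x y z z' : X.V} {s k s' k' : List X.B × List X.W}
    (hs : X.IsMorphism z y s) (hk : X.IsMorphism x z k)
    (hs' : X.IsMorphism z' y s') (hk' : X.IsMorphism x z' k')
    (hd : X.degree s = X.degree s')
    (e : mul X.swap s k = mul X.swap s' k') : s = s' ∧ k = k' := by
  obtain ⟨a, u⟩ := s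
  obtain ⟨b, v⟩ := k
  obtain ⟨a', u'⟩ := s'
  obtain ⟨b', v'⟩ := k'
  simp only [degree, Prod.mk.injEq] at hd
  simp only [mul, Prod.mk.injEq] at e
  obtain ⟨rfl, e₁⟩ := List.append_inj e.1 hd.1
  obtain ⟨e₂, rfl⟩ := List.append_inj e.2 (by simp [length_push, hd.2])
  obtain ⟨_, -, hu⟩ := hs
  obtain ⟨_, hb, -⟩ := hk
  obtain ⟨_, -, hu'⟩ := hs'
  obtain ⟨_, hb', -⟩ := hk'
  obtain ⟨rfl, rfl⟩ := push_inj hu hb hu' hb' (Prod.ext e₁ e₂)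
  exact ⟨rfl, rfl⟩

theorem isPath_range_unique {V A : Type u} {r s : A → V} {x x' y : V} {l : List A}
    (h : IsPath r s x l y) (h' : IsPath r s x' l y) : x = x' := by
  cases l with
  | nil => exact Eq.trans h (Eq.symm h')
  | cons e l => exact h.1.symm.trans h'.1

/-- Identifies the middle objects of two factorisations with equal words; an empty word does not
name its vertex, but its source does. -/
theorem isMorphism_range_unique {x y y' : X.V} {t : List X.B × List X.W}
    (h : X.IsMorphism x y t) (h' : X.IsMorphism x y' t) : y = y' := by
  obtain ⟨z, h₁, h₂⟩ := h
  obtain ⟨z', h₁', h₂'⟩ := h'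
  obtain rfl := isPath_range_unique h₂ h₂'
  exact isPath_range_unique h₁ h₁'

variable (X)

/-- The 2-graph of an exchange of red and blue edges. -/
abbrev twoGraph : TwoGraph.{u} where
  Obj := X.V
  cat := X.category
  d f := X.degree f.1
  d_id _ := rfl
  d_comp ν μ := X.degree_mul μ.1 ν.1
  factorisation := by
    rintro x y ⟨t, ht⟩ m n h
    obtain ⟨z, s, k, hs, hk, hsm, hkn, e⟩ := exists_factorisation ht h
    refine ⟨⟨z, ⟨s, hs⟩, ⟨k, hk⟩⟩, ⟨hsm, hkn, Subtype.ext e⟩, ?_⟩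
    rintro ⟨z', ⟨s', hs'⟩, ⟨k', hk'⟩⟩ ⟨hsm', -, e'⟩
    obtain ⟨rfl, rfl⟩ := factorisation_unique hs' hk' hs hk (hsm'.trans hsm.symm)
      ((Subtype.ext_iff.1 e').trans e.symm)
    obtain rfl := isMorphism_range_unique hk hk'
    rfl

theorem twoGraph_isCountable [Countable X.V] [Countable X.B] [Countable X.W] :
    X.twoGraph.IsCountable := by
  have : Function.Injective
      fun f : Σ x y : X.twoGraph.Obj, { t : List X.B × List X.W // X.IsMorphism x y t } =>
        (f.1, f.2.1, f.2.2.1) := by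
    rintro ⟨x, y, t, ht⟩ ⟨x', y', t', ht'⟩ h
    simp only [Prod.mk.injEq] at h
    obtain ⟨rfl, rfl, rfl⟩ := h
    rfl
  have : Countable (X.twoGraph.Obj × X.twoGraph.Obj × (List X.B × List X.W)) :=
    inferInstanceAs (Countable (X.V × X.V × (List X.B × List X.W)))
  exact Function.Injective.countable ‹Function.Injective _›

/-! ### The 1-skeleton and its squares -/

/-- The 2-coloured graph of blue and red edges. -/
abbrev graph : ColouredGraph.{u} where
  V := X.V
  E := X.B ⊕ X.W
  r := Sum.elim X.rB X.rW
  s := Sum.elim X.sB X.sW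
  c := Sum.elim (fun _ => 0) (fun _ => 1)

variable {X}

theorem ofDegree_ext {n : ℕ × ℕ} {l l' : X.twoGraph.OfDegree n} (hs : l.src = l'.src)
    (hr : l.rng = l'.rng) (h : l.hom.1 = l'.hom.1) : l = l' := by
  obtain ⟨x, y, ⟨t, ht⟩, _⟩ := l
  obtain ⟨x', y', ⟨t', ht'⟩, _⟩ := l'
  dsimp only at hs hr h
  subst hs hr h
  rfl

theorem exists_blue (l : X.twoGraph.OfDegree (1, 0)) :
    ∃ b, l.hom.1 = ([b], []) ∧ X.rB b = l.rng ∧ X.sB b = l.src := by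
  obtain ⟨x, y, ⟨⟨a, u⟩, z, h₁, h₂⟩, hd⟩ := l
  obtain ⟨ha, hu⟩ := Prod.mk.inj hd
  obtain ⟨b, rfl⟩ := List.length_eq_one_iff.1 ha
  obtain rfl := List.length_eq_zero_iff.1 hu
  exact ⟨b, rfl, h₁.1, Eq.trans h₁.2 h₂⟩

theorem exists_red (l : X.twoGraph.OfDegree (0, 1)) :
    ∃ w, l.hom.1 = ([], [w]) ∧ X.rW w = l.rng ∧ X.sW w = l.src := by
  obtain ⟨x, y, ⟨⟨a, u⟩, z, h₁, h₂⟩, hd⟩ := l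
  obtain ⟨ha, hu⟩ := Prod.mk.inj hd
  obtain ⟨w, rfl⟩ := List.length_eq_one_iff.1 hu
  obtain rfl := List.length_eq_zero_iff.1 ha
  exact ⟨w, rfl, h₂.1.trans (Eq.symm h₁), h₂.2⟩

/-- The blue edge of a morphism of degree `e₁`. -/
noncomputable def blue (l : X.twoGraph.OfDegree (1, 0)) : X.B := (exists_blue l).choose

/-- The red edge of a morphism of degree `e₂`. -/
noncomputable def red (l : X.twoGraph.OfDegree (0, 1)) : X.W := (exists_red l).choose

theorem blue_spec (l : X.twoGraph.OfDegree (1, 0)) :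
    l.hom.1 = ([blue l], []) ∧ X.rB (blue l) = l.rng ∧ X.sB (blue l) = l.src :=
  (exists_blue l).choose_spec

theorem red_spec (l : X.twoGraph.OfDegree (0, 1)) :
    l.hom.1 = ([], [red l]) ∧ X.rW (red l) = l.rng ∧ X.sW (red l) = l.src :=
  (exists_red l).choose_spec

theorem blue_bijective : Function.Bijective (blue (X := X)) := by
  constructor
  · intro l l' h
    obtain ⟨h₁, h₂, h₃⟩ := blue_spec l
    obtain ⟨h₁', h₂', h₃'⟩ := blue_spec l'
    rw [h] at h₁ h₂ h₃
    exact ofDegree_ext (h₃.symm.trans h₃') (h₂.symm.trans h₂') (h₁.trans h₁'.symm)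
  · intro b
    let l : X.twoGraph.OfDegree (1, 0) :=
      ⟨X.sB b, X.rB b, ⟨([b], []), X.sB b, ⟨rfl, rfl⟩, rfl⟩, rfl⟩
    have h : ([b], []) = ([blue l], ([] : List X.W)) := (blue_spec l).1
    exact ⟨l, by simpa using h.symm⟩

theorem red_bijective : Function.Bijective (red (X := X)) := by
  constructor
  · intro l l' h
    obtain ⟨h₁, h₂, h₃⟩ := red_spec l
    obtain ⟨h₁', h₂', h₃'⟩ := red_spec l'
    rw [h] at h₁ h₂ h₃
    exact ofDegree_ext (h₃.symm.trans h₃') (h₂.symm.trans h₂') (h₁.trans h₁'.symm)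
  · intro w
    let l : X.twoGraph.OfDegree (0, 1) :=
      ⟨X.sW w, X.rW w, ⟨([], [w]), X.rW w, rfl, rfl, rfl⟩, rfl⟩
    have h : (([] : List X.B), [w]) = ([], [red l]) := (red_spec l).1
    exact ⟨l, by simpa using h.symm⟩

variable (X)

/-- The 1-skeleton of the 2-graph consists of the blue and red edges. -/
noncomputable def skeletonHom : X.twoGraph.skeleton.Hom X.graph where
  onV x := x
  onE := Sum.map blue red
  r_onE
    | .inl l => (blue_spec l).2.1
    | .inr l => (red_spec l).2.1
  s_onE
    | .inl l => (blue_spec l).2.2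
    | .inr l => (red_spec l).2.2
  c_onE
    | .inl _ => rfl
    | .inr _ => rfl

variable {X}

open TwoGraph in
-- Both factorisations multiply to the same word: $f_1g_1$ is already blue-red, while multiplying
-- out $g_2f_2$ is exactly one exchange.
theorem swap_square (l : X.twoGraph.OfDegree (1, 1)) :
    X.sW (red (g₂ l)) = X.rB (blue (f₂ l)) ∧
      X.swap (red (g₂ l)) (blue (f₂ l)) = (blue (f₁ l), red (g₁ l)) := by
  refine ⟨(red_spec (g₂ l)).2.2.trans (blue_spec (f₂ l)).2.1.symm, ?_⟩
  have h₁ : mul X.swap (f₁ l).hom.1 (g₁ l).hom.1 = l.hom.1 :=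
    Subtype.ext_iff.1 (X.twoGraph.factor_spec l.hom (1, 0) (0, 1) l.deg).2.2
  have h₂ : mul X.swap (g₂ l).hom.1 (f₂ l).hom.1 = l.hom.1 :=
    Subtype.ext_iff.1 (X.twoGraph.factor_spec l.hom (0, 1) (1, 0) l.deg).2.2
  have h := h₂.trans h₁.symm
  rw [(blue_spec (f₁ l)).1, (red_spec (g₁ l)).1, (red_spec (g₂ l)).1, (blue_spec (f₂ l)).1] at h
  simpa [mul, push, pushLetter, Prod.ext_iff] using h

end Exchange

/-! ### The 2-graph of a textile system -/

namespace TextileSystem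

variable (T : TextileSystem.{u})

theorem exists_swap (hp : T.p.UniqueRPathLifting) (w : T.F.V) (e : T.E.E) :
    ∃ t : T.E.E × T.F.V, T.p.onV w = T.E.r e →
      ∃ f, T.F.r f = w ∧ T.p.onE f = e ∧ T.q.onE f = t.1 ∧ T.F.s f = t.2 := by
  by_cases h : T.p.onV w = T.E.r e
  · obtain ⟨f, ⟨h₁, h₂⟩, -⟩ := hp e w h.symm
    exact ⟨(T.q.onE f, T.F.s f), fun _ => ⟨f, h₁, h₂, rfl, rfl⟩⟩
  -- Arbitrary value for non-composable pairs.
  · exact ⟨(e, w), fun h' => absurd h' h⟩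

/-- The exchange of edges of `E` and vertices of `F` given by the edges of `F`. -/
noncomputable abbrev exchange (hp : T.p.UniqueRPathLifting) (hq : T.q.UniqueSPathLifting) :
    Exchange.{u} where
  V := T.E.V
  B := T.E.E
  W := T.F.V
  rB := T.E.r
  sB := T.E.s
  rW := T.q.onV
  sW := T.p.onV
  swap w e := (T.exists_swap hp w e).choose
  rB_swap w e h := by
    obtain ⟨f, h₁, h₂, h₃, h₄⟩ := (T.exists_swap hp w e).choose_spec h
    rw [← h₃, T.q.r_onE, h₁]
  sB_swap w e h := by
    obtain ⟨f, h₁, h₂, h₃, h₄⟩ := (T.exists_swap hp w e).choose_spec h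
    rw [← h₃, T.q.s_onE, h₄]
  sW_swap w e h := by
    obtain ⟨f, h₁, h₂, h₃, h₄⟩ := (T.exists_swap hp w e).choose_spec h
    rw [← h₄, ← T.p.s_onE, h₂]
  swap_inj w e w' e' h h' heq := by
    obtain ⟨f, h₁, h₂, h₃, h₄⟩ := (T.exists_swap hp w e).choose_spec h
    obtain ⟨f', h₁', h₂', h₃', h₄'⟩ := (T.exists_swap hp w' e').choose_spec h'
    rw [← heq] at h₃' h₄'
    -- Equal outputs mean equal $q(f)$ and $s(f)$, so both edges are the same $s$-lift along $q$.
    have : f = f' := (hq (T.q.onE f) (T.F.s f) (T.q.s_onE f)).unique ⟨rfl, rfl⟩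
      ⟨h₄'.trans h₄.symm, h₃'.trans h₃.symm⟩
    subst this
    exact ⟨h₁.symm.trans h₁', h₂.symm.trans h₂'⟩
  swap_surj e w h := by
    -- The preimage is the other side $(r(f),p(f))$ of the $s$-lift `f`; uniqueness of $r$-lifts
    -- makes the edge chosen for that pair equal to `f`.
    obtain ⟨f, ⟨h₁, h₂⟩, -⟩ := hq e w h
    have h' : T.p.onV (T.F.r f) = T.E.r (T.p.onE f) := (T.p.r_onE f).symm
    obtain ⟨f', h₁', h₂', h₃', h₄'⟩ := (T.exists_swap hp _ _).choose_spec h'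
    obtain rfl : f' = f := (hp _ _ h'.symm).unique ⟨h₁', h₂'⟩ ⟨rfl, rfl⟩
    exact ⟨_, _, h', Prod.ext (h₃'.symm.trans h₂) (h₄'.symm.trans h₁)⟩

/-- The square of $l$ is $\phi_f$ for the edge $f$ that exchanges $g_2f_2$ into $f_1g_1$; its
vertices are endpoints of its two blue edges. -/
theorem isAssociatedTwoGraph_exchange (hp : T.p.UniqueRPathLifting)
    (hq : T.q.UniqueSPathLifting) : T.IsAssociatedTwoGraph (T.exchange hp hq).twoGraph := by
  refine ⟨(T.exchange hp hq).skeletonHom, Function.bijective_id,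
    Sum.map_bijective.2 ⟨Exchange.blue_bijective, Exchange.red_bijective⟩, ?_⟩
  rintro _ ⟨l, rfl⟩
  obtain ⟨h, e⟩ := Exchange.swap_square l
  obtain ⟨f, h₁, h₂, h₃, h₄⟩ := (T.exists_swap hp _ _).choose_spec h
  have e₁ := (Prod.ext_iff.1 e).1
  have e₂ := (Prod.ext_iff.1 e).2
  have h₃ := h₃.trans e₁
  have h₄ := h₄.trans e₂
  refine ⟨f, ColouredGraph.Hom.ext ?_ ?_⟩
  · funext v
    cases v
    · exact (congrArg T.E.r h₃).trans (Exchange.blue_spec (TwoGraph.f₁ l)).2.1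
    · exact (congrArg T.E.s h₃).trans (Exchange.blue_spec (TwoGraph.f₁ l)).2.2
    · exact (congrArg T.E.r h₂).trans (Exchange.blue_spec (TwoGraph.f₂ l)).2.1
    · exact (congrArg T.E.s h₂).trans (Exchange.blue_spec (TwoGraph.f₂ l)).2.2
  · funext v
    cases v
    · exact congrArg Sum.inl h₃
    · exact congrArg Sum.inr h₁
    · exact congrArg Sum.inl h₂
    · exact congrArg Sum.inr h₄

end TextileSystem

/-! ### Morphisms of degree `e₁ + e₂` -/

namespace TwoGraph

variable {L : TwoGraph.{u}}

/-- The product of composable morphisms of given degrees. -/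
def OfDegree.mul {m n : ℕ × ℕ} (a : L.OfDegree m) (b : L.OfDegree n) (h : b.rng = a.src) :
    L.OfDegree (m + n) where
  src := b.src
  rng := a.rng
  hom := b.hom ≫ eqToHom h ≫ a.hom
  deg := by
    obtain ⟨x, y, a, rfl⟩ := a
    obtain ⟨x', y', b, rfl⟩ := b
    dsimp only at h
    subst h
    simp [L.d_comp]

theorem OfDegree.head_mul_tail {m n : ℕ × ℕ} (l : L.OfDegree (m + n)) :
    (l.head m n rfl).mul (l.tail m n rfl) rfl = l := by
  have h := (L.factor_spec l.hom m n l.deg).2.2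
  obtain ⟨x, y, l, hl⟩ := l
  simpa [OfDegree.mul, OfDegree.head, OfDegree.tail] using h

/-- The pair `(a, b)` factorises its own product, so by uniqueness it is the chosen factorisation.
-/
theorem OfDegree.head_mul {m n : ℕ × ℕ} (a : L.OfDegree m) (b : L.OfDegree n)
    (h : b.rng = a.src) : (a.mul b h).head m n rfl = a ∧ (a.mul b h).tail m n rfl = b := by
  obtain ⟨x, y, a, ha⟩ := a
  obtain ⟨x', y', b, hb⟩ := b
  dsimp only at h
  subst h
  have hd : L.d (b ≫ 𝟙 y' ≫ a) = m + n := by rw [Category.id_comp, L.d_comp, ha, hb]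
  have hu : L.factor (b ≫ 𝟙 y' ≫ a) m n hd = ⟨y', a, b⟩ :=
    (L.factorisation _ m n hd).unique (L.factor_spec _ m n hd)
      ⟨ha, hb, by rw [Category.id_comp]⟩
  constructor
  · refine OfDegree.ext ?_ rfl ?_
    · change (L.factor (b ≫ 𝟙 y' ≫ a) m n hd).1 = y'
      rw [hu]
    · change HEq (L.factor (b ≫ 𝟙 y' ≫ a) m n hd).2.1 a
      rw [hu]
  · refine OfDegree.ext rfl ?_ ?_
    · change (L.factor (b ≫ 𝟙 y' ≫ a) m n hd).1 = y'
      rw [hu]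
    · change HEq (L.factor (b ≫ 𝟙 y' ≫ a) m n hd).2.2 b
      rw [hu]

/-- With `exists_f₁_g₁`, this identifies morphisms of degree $e_1+e_2$ with composable blue-red
pairs. -/
theorem eq_of_f₁_g₁ {l l' : L.OfDegree (1, 1)} (hf : f₁ l = f₁ l') (hg : g₁ l = g₁ l') :
    l = l' := by
  have h : (f₁ l).mul (g₁ l) rfl = (f₁ l').mul (g₁ l') rfl := by
    simp only [hf, hg]
  exact (OfDegree.head_mul_tail (m := (1, 0)) (n := (0, 1)) l).symm.trans
    (h.trans (OfDegree.head_mul_tail (m := (1, 0)) (n := (0, 1)) l'))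

theorem exists_f₁_g₁ (a : L.OfDegree (1, 0)) (b : L.OfDegree (0, 1)) (h : b.rng = a.src) :
    ∃ l : L.OfDegree (1, 1), f₁ l = a ∧ g₁ l = b :=
  ⟨a.mul b h, a.head_mul b h⟩

end TwoGraph

/-! ### Isomorphisms of chain complexes -/

/-- An isomorphism of three-term complexes. -/
noncomputable def threeTermComplexIso {C₀ C₁ C₂ D₀ D₁ D₂ : AddCommGrpCat.{u}} {d₁ : C₁ ⟶ C₀}
    {d₂ : C₂ ⟶ C₁} {h : d₂ ≫ d₁ = 0} {d₁' : D₁ ⟶ D₀} {d₂' : D₂ ⟶ D₁} {h' : d₂' ≫ d₁' = 0}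
    (i₀ : C₀ ≅ D₀) (i₁ : C₁ ≅ D₁) (i₂ : C₂ ≅ D₂) (w₁ : i₁.hom ≫ d₁' = d₁ ≫ i₀.hom)
    (w₂ : i₂.hom ≫ d₂' = d₂ ≫ i₁.hom) :
    threeTermComplex d₁ d₂ h ≅ threeTermComplex d₁' d₂' h' :=
  HomologicalComplex.Hom.isoOfComponents
    (fun
      | 0 => i₀
      | 1 => i₁
      | 2 => i₂
      | _ + 3 => Iso.refl (AddCommGrpCat.of PUnit))
    (by
      rintro i j rfl
      simp only [threeTermComplex, ChainComplex.of_d]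
      match j with
      | 0 => exact w₁
      | 1 => exact w₂
      | _ + 2 => exact Limits.comp_zero.trans Limits.zero_comp.symm)

theorem exists_equiv_of_colour {A B C D : Type u} {φ : A ⊕ B → C ⊕ D}
    (hφ : Function.Bijective φ)
    (hc : ∀ x, Sum.elim (fun _ => (0 : Fin 2)) (fun _ => 1) (φ x) =
      Sum.elim (fun _ => 0) (fun _ => 1) x) :
    ∃ (α : A ≃ C) (β : B ≃ D), ∀ x, φ x = Sum.map α β x := by
  have hl (a : A) : ∃ c, φ (.inl a) = .inl c := by
    have := hc (.inl a)
    cases h : φ (.inl a) with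
    | inl c => exact ⟨c, rfl⟩
    | inr d => simp [h] at this
  have hr (b : B) : ∃ d, φ (.inr b) = .inr d := by
    have := hc (.inr b)
    cases h : φ (.inr b) with
    | inl c => simp [h] at this
    | inr d => exact ⟨d, rfl⟩
  choose α hα using hl
  choose β hβ using hr
  have e : φ = Sum.map α β := by
    funext x
    cases x
    · exact hα _
    · exact hβ _
  have := Sum.map_bijective.1 (e ▸ hφ)
  exact ⟨.ofBijective α this.1, .ofBijective β this.2, fun x => congrFun e x⟩

namespace TextileSystem

variable {T : TextileSystem.{u}}

open TwoGraph

/-- A square isomorphism, split into bijections of vertices, of edges of each colour and of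
squares. -/
theorem IsAssociatedTwoGraph.exists_equivs (hq : T.q.UniqueSPathLifting) {L : TwoGraph.{u}}
    (hL : T.IsAssociatedTwoGraph L) :
    ∃ (ν : L.Obj ≃ T.E.V) (α : L.OfDegree (1, 0) ≃ T.E.E) (β : L.OfDegree (0, 1) ≃ T.F.V)
      (γ : L.OfDegree (1, 1) ≃ T.F.E),
      (∀ a, T.E.r (α a) = ν a.rng ∧ T.E.s (α a) = ν a.src) ∧
      (∀ b, T.q.onV (β b) = ν b.rng ∧ T.p.onV (β b) = ν b.src) ∧
      ∀ l, T.q.onE (γ l) = α (f₁ l) ∧ T.p.onE (γ l) = α (f₂ l) ∧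
        T.F.s (γ l) = β (g₁ l) ∧ T.F.r (γ l) = β (g₂ l) := by
  obtain ⟨φ, hV, hE, hsq⟩ := hL
  obtain ⟨α, β, hαβ⟩ : ∃ (α : L.OfDegree (1, 0) ≃ T.E.E) (β : L.OfDegree (0, 1) ≃ T.F.V),
    ∀ x, φ.onE x = Sum.map α β x := exists_equiv_of_colour hE φ.c_onE
  have hα (a) : T.E.r (α a) = φ.onV a.rng ∧ T.E.s (α a) = φ.onV a.src := by
    have h := (hαβ (.inl a)).symm
    exact ⟨(congrArg T.colouredGraph.r h).trans (φ.r_onE (.inl a)),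
      (congrArg T.colouredGraph.s h).trans (φ.s_onE (.inl a))⟩
  have hβ (b) : T.q.onV (β b) = φ.onV b.rng ∧ T.p.onV (β b) = φ.onV b.src := by
    have h := (hαβ (.inr b)).symm
    exact ⟨(congrArg T.colouredGraph.r h).trans (φ.r_onE (.inr b)),
      (congrArg T.colouredGraph.s h).trans (φ.s_onE (.inr b))⟩
  have hγ (l : L.OfDegree (1, 1)) : ∃ f, T.q.onE f = α (f₁ l) ∧ T.p.onE f = α (f₂ l) ∧
      T.F.s f = β (g₁ l) ∧ T.F.r f = β (g₂ l) := by
    obtain ⟨f, hf⟩ := hsq _ ⟨l, rfl⟩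
    have key (x : ModelEdge) : (T.square f).onE x = Sum.map α β ((L.square l).onE x) := by
      rw [hf]
      exact hαβ _
    exact ⟨f, Sum.inl.inj (key .ε₁zero), Sum.inl.inj (key .ε₁e₂), Sum.inr.inj (key .ε₂e₁),
      Sum.inr.inj (key .ε₂zero)⟩
  choose γ hγ using hγ
  -- The hypothesis only sends squares of `L` into $\mathcal C_T$. That all are hit, once each,
  -- follows because both sides are parametrised by composable blue-red pairs.
  have hbij : Function.Bijective γ := by
    constructor
    · intro l l' h
      have h₁ := hγ l
      rw [h] at h₁
      exact eq_of_f₁_g₁ (α.injective (h₁.1.symm.trans (hγ l').1))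
        (β.injective (h₁.2.2.1.symm.trans (hγ l').2.2.1))
    · intro f
      -- The pair $(q(f),s(f))$ transported to `L` is composable because `φ` is injective on
      -- vertices.
      obtain ⟨l, h₁, h₂⟩ := exists_f₁_g₁ (α.symm (T.q.onE f)) (β.symm (T.F.s f)) (by
        apply hV.1
        rw [← (hα _).2, ← (hβ _).1, Equiv.apply_symm_apply, Equiv.apply_symm_apply, T.q.s_onE])
      refine ⟨l, (hq _ _ (T.q.s_onE f)).unique ⟨?_, ?_⟩ ⟨rfl, rfl⟩⟩
      · rw [(hγ l).2.2.1, h₂, Equiv.apply_symm_apply]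
      · rw [(hγ l).1, h₁, Equiv.apply_symm_apply]
  exact ⟨.ofBijective φ.onV hV, α, β, .ofBijective γ hbij, hα, hβ, hγ⟩

theorem IsAssociatedTwoGraph.nonempty_chainComplex_iso (hq : T.q.UniqueSPathLifting)
    {L : TwoGraph.{u}} (hL : T.IsAssociatedTwoGraph L) :
    Nonempty (L.chainComplex ≅ T.chainComplex) := by
  obtain ⟨ν, α, β, γ, hα, hβ, hγ⟩ := hL.exists_equivs hq
  let i₁ := AddEquiv.prodCongr (FreeAbelianGroup.equivOfEquiv α) (FreeAbelianGroup.equivOfEquiv β)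
  have hi (x y) : i₁ (x, y) =
      (FreeAbelianGroup.equivOfEquiv α x, FreeAbelianGroup.equivOfEquiv β y) := rfl
  refine ⟨threeTermComplexIso (FreeAbelianGroup.equivOfEquiv ν).toAddCommGrpIso
    i₁.toAddCommGrpIso (FreeAbelianGroup.equivOfEquiv γ).toAddCommGrpIso ?_ ?_⟩
  · have : T.boundary₁.comp i₁.toAddMonoidHom =
        (FreeAbelianGroup.equivOfEquiv ν).toAddMonoidHom.comp L.boundary₁ := by
      -- Each map out of the direct sum is split into its restrictions to the two summands, where
      -- generators suffice.
      rw [← AddMonoidHom.coprod_unique (T.boundary₁.comp _),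
        ← AddMonoidHom.coprod_unique (AddMonoidHom.comp _ L.boundary₁)]
      congr 1 <;> apply FreeAbelianGroup.lift_ext
      · intro a
        simp [hi, TextileSystem.boundary₁, TwoGraph.boundary₁, DirectedGraph.boundary,
          FreeAbelianGroup.equivOfEquiv, hα]
      · intro b
        simp [hi, TextileSystem.boundary₁, TwoGraph.boundary₁, DirectedGraph.boundary,
          FreeAbelianGroup.equivOfEquiv, hβ]
    exact congrArg AddCommGrpCat.ofHom this
  · have : T.boundary₂.comp (FreeAbelianGroup.equivOfEquiv γ).toAddMonoidHom =
        i₁.toAddMonoidHom.comp L.boundary₂ := by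
      apply FreeAbelianGroup.lift_ext
      intro l
      simp [hi, TextileSystem.boundary₂, TwoGraph.boundary₂, DirectedGraph.boundary,
        FreeAbelianGroup.equivOfEquiv, hγ]
    exact congrArg AddCommGrpCat.ofHom this

end TextileSystem

end Textile

theorem mainTheorem8 (T : Textile.TextileSystem.{u})
    (hp : T.p.UniqueRPathLifting) (hq : T.q.UniqueSPathLifting) :
    (∃ L : Textile.TwoGraph.{u}, T.IsAssociatedTwoGraph L ∧
      (Countable T.E.V → Countable T.E.E → Countable T.F.V → L.IsCountable)) ∧
    ∀ L : Textile.TwoGraph.{u}, T.IsAssociatedTwoGraph L →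
      Nonempty (L.chainComplex ≅ T.chainComplex) ∧
      ∀ n : ℕ, Nonempty (L.chainComplex.homology n ≅ T.chainComplex.homology n) := by
  refine ⟨⟨_, T.isAssociatedTwoGraph_exchange hp hq,
    fun _ _ _ => (T.exchange hp hq).twoGraph_isCountable⟩, fun L hL => ?_⟩
  obtain ⟨i⟩ := hL.nonempty_chainComplex_iso hq
  exact ⟨⟨i⟩, fun n => ⟨(HomologicalComplex.homologyFunctor _ _ n).mapIso i⟩⟩
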